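/- Call a finite closure space $(J,\overline{\phantom{x}})$ a convex geometry if it satisfies the anti-exchange axiom: for all closed $A\subseteq J$ and all $x\ne y$ in $J$, if $x\in\overline{A\cup\{y\}}$ and $x\notin A$, then $y\notin\overline{A\cup\{x\}}$. A set $D\subseteq J$ is dependent if $x\in\overline{D\setminus\{x\}}$ for some $x\in D$; a circuit is an inclusion-minimal dependent set; a convex $4$-geometry is a convex geometry all of whose circuits have exactly four elements. The layers of $J$ are $L_n=\{x\in J_n : x\notin\overline{J_n\setminus\{x\}}\}$, where $J_n=J\setminus\bigcup_{i<n}L_i$, so that $L_0$ is the set of extreme points of $J$; $J$ is two-layered if $L_0,L_1\neq\emptyset$ and $L_0\cup L_1=J$. A realization of $J$ is an injective map $f:J\to\mathbb{R}^2$ whose image has no three collinear points and which satisfies $f(\overline{Y})=\operatorname{conv}(f(Y))\cap f(J)$ for all $Y\subseteq J$; $J$ is realizable if it has a realization. The order type $t_f$ of a realization $f$ assigns to each ordered triple $(a,b,c)$ of distinct elements of $J$ the orientation $\pm1$ of $(f(a),f(b),f(c))$. Two order types $t_1,t_2$ on $J$ are equivalent if there is a bijection $\delta:J\to J$ with $t_2(a,b,c)=t_1(\delta(a),\delta(b),\delta(c))$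 for all $(a,b,c)$. Let $\underline{\mathrm{OT}}(J)$ be the set of equivalence classes of order types of realizations of $J$. Corollary. The growth of $|\underline{\mathrm{OT}}(J(p))|$ for two-layered convex $4$-geometries $J(p)$ of size $O(p)$ cannot be polynomially bounded in $p$. More precisely, there is a sequence $(J(p))_{p\in\mathbb{N}}$ of realizable two-layered convex $4$-geometries such that $0<\lim_{p\to\infty}|J(p)|/p<\infty$ and such that, for every real polynomial $P$, $|\underline{\mathrm{OT}}(J(p))|>P(p)$ for all sufficiently large $p$. -/

import Mathlib

open Filter Topology

/-! ### Closure spaces, convex geometries, layers -/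

namespace ConvexGeom

variable {J : Type*}

/-- The anti-exchange axiom of a closure space `(J, cl)`. -/
def AntiExchange (cl : ClosureOperator (Set J)) : Prop :=
  ∀ A : Set J, cl A = A → ∀ x y : J, x ≠ y →
    x ∈ cl (A ∪ {y}) → x ∉ A → y ∉ cl (A ∪ {x})

/-- A set `D` is dependent if some `x ∈ D` lies in the closure of `D \ {x}`. -/
def Dependent (cl : ClosureOperator (Set J)) (D : Set J) : Prop :=
  ∃ x ∈ D, x ∈ cl (D \ {x})

/-- A circuit is an inclusion-minimal dependent set. -/
def IsCircuit (cl : ClosureOperator (Set J)) (C : Set J) : Prop :=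
  Minimal (Dependent cl) C

/-- A (finite) convex 4-geometry: a closure space with the anti-exchange property
all of whose circuits have exactly four elements. -/
structure IsConvexFourGeometry (cl : ClosureOperator (Set J)) : Prop where
  finite : Finite J
  antiExchange : AntiExchange cl
  circuit_card : ∀ C : Set J, IsCircuit cl C → C.ncard = 4

/-- The extreme points of the subspace of `(J, cl)` carried by `S`, that is, of `S` with the
restricted closure operator `Y ↦ cl Y ∩ S`. -/
def extremePts (cl : ClosureOperator (Set J)) (S : Set J) : Set J :=
  {x ∈ S | x ∉ cl (S \ {x})}

/-- What is left of `J` after the first `n` layers have been removed. -/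
def remaining (cl : ClosureOperator (Set J)) : ℕ → Set J
  | 0 => Set.univ
  | n + 1 => remaining cl n \ extremePts cl (remaining cl n)

/-- The `n`-th layer; `layer cl 0` is the outermost layer. -/
def layer (cl : ClosureOperator (Set J)) (n : ℕ) : Set J :=
  extremePts cl (remaining cl n)

/-- The complete family of layers of `(J, cl)` consists of exactly the `m` nonempty layers
`layer cl 0, …, layer cl (m - 1)`. -/
def HasExactlyLayers (cl : ClosureOperator (Set J)) (m : ℕ) : Prop :=
  (∀ n < m, (layer cl n).Nonempty) ∧ ⋃ n < m, layer cl n = Set.univ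

/-! ### Planar realizations and order types -/

/-- The points `f j` are pairwise distinct and no three of them lie on a line. -/
def InGeneralPosition (f : J → ℝ × ℝ) : Prop :=
  Function.Injective f ∧
    ∀ a b c : J, a ≠ b → a ≠ c → b ≠ c → ¬ Collinear ℝ {f a, f b, f c}

/-- `f` realizes `(J, cl)`: its image is a point configuration in general position, and `f` is
an isomorphism from `(J, cl)` onto the image with the closure operator `Y ↦ conv Y ∩ f(J)`. -/
def IsRealization (cl : ClosureOperator (Set J)) (f : J → ℝ × ℝ) : Prop :=
  InGeneralPosition f ∧ ∀ Y : Set J, f '' (cl Y) = convexHull ℝ (f '' Y) ∩ Set.range f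

/-- A closure space is realizable if some planar point configuration realizes it. -/
def IsRealizable (cl : ClosureOperator (Set J)) : Prop :=
  ∃ f : J → ℝ × ℝ, IsRealization cl f

/-- Ordered triples of distinct elements of `J`. -/
@[ext]
structure OrderedTriple (J : Type*) where
  fst : J
  snd : J
  thd : J
  fst_ne_snd : fst ≠ snd
  fst_ne_thd : fst ≠ thd
  snd_ne_thd : snd ≠ thd

/-- The map on ordered triples induced by a bijection of `J`. -/
def OrderedTriple.map (δ : Equiv.Perm J) (s : OrderedTriple J) : OrderedTriple J where
  fst := δ s.fst
  snd := δ s.snd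
  thd := δ s.thd
  fst_ne_snd := δ.injective.ne s.fst_ne_snd
  fst_ne_thd := δ.injective.ne s.fst_ne_thd
  snd_ne_thd := δ.injective.ne s.snd_ne_thd

/-- The orientation of a triple of points of the plane: `1` if it is anticlockwise, `-1` if it is
clockwise (and `0` if the points are collinear). -/
noncomputable def orientation (x y z : ℝ × ℝ) : SignType :=
  SignType.sign ((y.1 - x.1) * (z.2 - x.2) - (y.2 - x.2) * (z.1 - x.1))

/-- The order type `t_f` induced by `f`. If `f` is in general position, its values are `±1`. -/
noncomputable def orderTypeOf (f : J → ℝ × ℝ) : OrderedTriple J → SignType :=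
  fun s => orientation (f s.fst) (f s.snd) (f s.thd)

/-- The set of all order types induced by the realizations of `(J, cl)`. -/
def OrderTypes (cl : ClosureOperator (Set J)) : Set (OrderedTriple J → SignType) :=
  {t | ∃ f : J → ℝ × ℝ, IsRealization cl f ∧ t = orderTypeOf f}

/-- Equivalence of order types on `J`: they differ by a bijection of `J`. -/
def Equivalent (t₁ t₂ : OrderedTriple J → SignType) : Prop :=
  ∃ δ : Equiv.Perm J, t₂ = t₁ ∘ OrderedTriple.map δ

theorem equivalent_equivalence : Equivalence (Equivalent (J := J)) where
  refl _ := ⟨Equiv.refl J, rfl⟩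
  symm := by
    rintro t₁ t₂ ⟨δ, rfl⟩
    refine ⟨δ.symm, ?_⟩
    funext s
    simp [OrderedTriple.map]
  trans := by
    rintro t₁ t₂ t₃ ⟨δ, rfl⟩ ⟨ε, rfl⟩
    exact ⟨ε.trans δ, rfl⟩

/-- Equivalence of order types, on the order types of the realizations of `(J, cl)`. -/
def orderTypesSetoid (cl : ClosureOperator (Set J)) : Setoid (OrderTypes cl) where
  r t₁ t₂ := Equivalent t₁.1 t₂.1
  iseqv :=
    ⟨fun t => equivalent_equivalence.refl t.1, fun h => equivalent_equivalence.symm h,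
      fun h₁ h₂ => equivalent_equivalence.trans h₁ h₂⟩

/-- The number of equivalence classes of order types of realizations of `(J, cl)`. -/
noncomputable def numOrderTypes (cl : ClosureOperator (Set J)) : ℕ :=
  Nat.card (Quotient (orderTypesSetoid cl))

end ConvexGeom

/-! ### Polygons with a point next to each of some disjoint edges -/

namespace EdgeWords

open ConvexGeom

variable {n : ℕ}

/-! The closure adds the inner point of an edge as soon as both ends and any third point are
present. It does not see on which side of the edge the extra vertex `some (i, 3)` lies, so a word
`w` of `n` bits may choose the side in every block.

Put the points at the abscissae `rank w` on the parabola `y = x ^ 2` and lift the inner points by `3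
/ 2`. The chord between the two neighbours of a point passes `1` above the parabola, and every other
chord over that point passes at least `2` above it. Hence an inner point lies just inside its own
edge and outside every other chord, and all `2 ^ n` words realize the same geometry
(`isRealization_place`).

The only clockwise triples in increasing rank are the edges with their inner points. An equivalence
that fixes the base point preserves ranks, hence also the places of these triples, and these spell
`w` (`eq_of_orderTypeOf_eq_comp`). Each class therefore contains at most `4 * n + 1` words, and `2 ^
n / (4 * n + 1)` outgrows every polynomial. -/

/-- The ground set: a base point `none` and `n` blocks, each consisting of the ends
`some (i, 0)` and `some (i, 2)` of an edge, an inner point `some (i, 1)` next to that edge, and a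
further vertex `some (i, 3)`. -/
abbrev Pt (n : ℕ) : Type := Option (Fin n × Fin 4)

/-- Add to `Y` the inner points of all edges contained in `Y`, if `Y` has a third point. -/
def addInner (Y : Set (Pt n)) : Set (Pt n) :=
  {y | y ∈ Y ∨ ∃ i : Fin n, y = some (i, 1) ∧ some (i, 0) ∈ Y ∧ some (i, 2) ∈ Y ∧
    ∃ z ∈ Y, z ≠ some (i, 0) ∧ z ≠ some (i, 2)}

theorem mem_addInner_of_ne {Y : Set (Pt n)} {y : Pt n} (hy : ∀ i, y ≠ some (i, 1)) :
    y ∈ addInner Y ↔ y ∈ Y :=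
  ⟨fun h => h.elim id fun ⟨i, hi, _⟩ => absurd hi (hy i), Or.inl⟩

theorem end_mem_addInner {Y : Set (Pt n)} {i : Fin n} {c : Fin 4} (hc : c ≠ 1) :
    some (i, c) ∈ addInner Y ↔ some (i, c) ∈ Y :=
  mem_addInner_of_ne fun j h => hc (by simpa using congrArg (Option.map Prod.snd) h)

theorem addInner_mono {Y Z : Set (Pt n)} (h : Y ⊆ Z) : addInner Y ⊆ addInner Z := by
  rintro y (hy | ⟨i, rfl, h0, h2, z, hz, hz'⟩)
  · exact Or.inl (h hy)
  · exact Or.inr ⟨i, rfl, h h0, h h2, z, h hz, hz'⟩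

theorem addInner_addInner (Y : Set (Pt n)) : addInner (addInner Y) = addInner Y := by
  refine Set.Subset.antisymm ?_ fun y hy => Or.inl hy
  rintro y (hy | ⟨i, rfl, h0, h2, z, hz, hz0, hz2⟩)
  · exact hy
  · rw [end_mem_addInner (by decide)] at h0 h2
    refine Or.inr ⟨i, rfl, h0, h2, ?_⟩
    -- A third point that was itself added can be replaced by an end of its own edge, or by its own
    -- third point if the edge is the same.
    rcases hz with hz | ⟨j, rfl, h0', h2', z', hz', hz0', hz2'⟩
    · exact ⟨z, hz, hz0, hz2⟩
    · by_cases hij : j = i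
      · subst hij
        exact ⟨z', hz', hz0', hz2'⟩
      · exact ⟨_, h0', by simp [hij], by simp⟩

/-- The closure operator `addInner`. -/
def edgeClosure (n : ℕ) : ClosureOperator (Set (Pt n)) :=
  ClosureOperator.mk' addInner (fun _ _ h => addInner_mono h) (fun _ _ hy => Or.inl hy)
    (fun Y => (addInner_addInner Y).le)

theorem edgeClosure_apply (Y : Set (Pt n)) : edgeClosure n Y = addInner Y := rfl

/-! ### Convex geometry axioms and circuits. -/

theorem antiExchange_edgeClosure : AntiExchange (edgeClosure n) := by
  intro A hA x y hxy hx hxA hy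
  simp only [edgeClosure_apply] at hA hx hy
  have hyA : y ∉ A := by
    intro hyA
    rw [Set.union_eq_self_of_subset_right (Set.singleton_subset_iff.2 hyA), hA] at hx
    exact hxA hx
  rcases hx with hx | ⟨i, rfl, h0, h2, z, hz, hz0, hz2⟩
  · exact hx.elim hxA hxy
  rcases hy with hy | ⟨j, rfl, g0, g2, -⟩
  · exact hy.elim hyA fun h => hxy h.symm
  have h0 : some (i, 0) ∈ A := by simpa using h0
  have h2 : some (i, 2) ∈ A := by simpa using h2
  have g0 : some (j, 0) ∈ A := by simpa using g0
  have hij : j ≠ i := by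
    rintro rfl
    exact hxy rfl
  -- An end of edge `j` serves as third point for edge `i`, so `x` is already in the closure of `A`.
  refine hxA (hA ▸ Or.inr ⟨i, rfl, h0, h2, _, g0, by simp [hij], by simp⟩)

theorem ncard_of_isCircuit {C : Set (Pt n)} (hC : IsCircuit (edgeClosure n) C) :
    C.ncard = 4 := by
  obtain ⟨⟨x, hx, hxC⟩, hmin⟩ := hC
  rcases hxC with h | ⟨i, rfl, h0, h2, z, hz, hz0, hz2⟩
  · exact absurd rfl h.2
  have hz1 : z ≠ some (i, 1) := hz.2
  have hD : Dependent (edgeClosure n) {some (i, 1), some (i, 0), some (i, 2), z} :=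
    ⟨some (i, 1), by simp, Or.inr ⟨i, rfl, by simp, by simp, z, by simp [hz1], hz0, hz2⟩⟩
  have hsub : ({some (i, 1), some (i, 0), some (i, 2), z} : Set (Pt n)) ⊆ C := by
    rintro y (rfl | rfl | rfl | rfl)
    exacts [hx, h0.1, h2.1, hz.1]
  have hCD : C = {some (i, 1), some (i, 0), some (i, 2), z} := (hmin hD hsub).antisymm hsub
  rw [hCD, Set.ncard_insert_of_notMem (by simp [hz1.symm]),
    Set.ncard_insert_of_notMem (by simp [hz0.symm]), Set.ncard_pair hz2.symm]

theorem isConvexFourGeometry_edgeClosure : IsConvexFourGeometry (edgeClosure n) :=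
  ⟨inferInstance, antiExchange_edgeClosure, fun _ => ncard_of_isCircuit⟩

/-! ### Layers. -/

theorem layer_zero : layer (edgeClosure n) 0 = {y | ∀ i, y ≠ some (i, 1)} := by
  ext y
  simp only [layer, remaining, extremePts, edgeClosure_apply, Set.mem_ofPred_eq, Set.mem_univ,
    true_and]
  constructor
  · rintro hy i rfl
    exact hy (Or.inr ⟨i, rfl, by simp, by simp, none, by simp, by simp, by simp⟩)
  · intro hy h
    exact ((mem_addInner_of_ne hy).1 h).2 rfl

theorem remaining_one : remaining (edgeClosure n) 1 = {y | ∃ i, y = some (i, 1)} := by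
  change Set.univ \ layer (edgeClosure n) 0 = _
  rw [layer_zero]
  ext y
  simp

theorem layer_one : layer (edgeClosure n) 1 = {y | ∃ i, y = some (i, 1)} := by
  rw [layer, remaining_one]
  refine Set.Subset.antisymm (fun y hy => hy.1) ?_
  rintro y ⟨i, rfl⟩
  refine ⟨⟨i, rfl⟩, ?_⟩
  rintro (h | ⟨j, -, ⟨⟨k, hk⟩, -⟩, -⟩)
  · exact h.2 rfl
  · simp at hk

theorem hasExactlyLayers_edgeClosure : HasExactlyLayers (edgeClosure (n + 1)) 2 := by
  constructor
  · intro m hm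
    interval_cases m
    · rw [layer_zero]
      exact ⟨none, by simp⟩
    · rw [layer_one]
      exact ⟨some (0, 1), 0, rfl⟩
  · refine Set.eq_univ_of_forall fun y => ?_
    simp only [Set.mem_iUnion, exists_prop]
    by_cases hy : ∃ i, y = some (i, 1)
    · exact ⟨1, by simp, layer_one ▸ hy⟩
    · exact ⟨0, by simp, layer_zero ▸ not_exists.1 hy⟩

/-! ### Placing the points next to a parabola -/

/-- The position of a point in the linear arrangement given by `w`: the block `i` is arranged as
`0, 1, 2, 3` or as `3, 0, 1, 2`, according to the bit `w i`. -/
def rank (w : Fin n → Bool) : Pt n → ℕ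
  | none => 0
  | some (i, c) => 1 + 4 * i + (if w i then (c : ℕ) else ((c + 1 : Fin 4) : ℕ))

theorem rank_injective (w : Fin n → Bool) : Function.Injective (rank w) := by
  have key : ∀ (b : Bool) (c : Fin 4),
      (if b then (c : ℕ) else ((c + 1 : Fin 4) : ℕ)) < 4 := by decide
  have key' : ∀ (b : Bool) (c d : Fin 4), (if b then (c : ℕ) else ((c + 1 : Fin 4) : ℕ)) =
      (if b then (d : ℕ) else ((d + 1 : Fin 4) : ℕ)) → c = d := by decide
  rintro (_ | ⟨i, c⟩) (_ | ⟨j, d⟩) h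
  · rfl
  · simp only [rank] at h
    omega
  · simp only [rank] at h
    omega
  · simp only [rank] at h
    have hc := key (w i) c
    have hd := key (w j) d
    have hij : i = j := Fin.ext (by omega)
    subst hij
    rw [key' (w i) c d (by omega)]

theorem rank_lt (w : Fin n → Bool) (y : Pt n) : rank w y < 4 * n + 1 := by
  have key : ∀ (b : Bool) (c : Fin 4),
      (if b then (c : ℕ) else ((c + 1 : Fin 4) : ℕ)) < 4 := by decide
  rcases y with _ | ⟨i, c⟩
  · simp [rank]
  · have hc := key (w i) c
    have hi := i.2
    simp only [rank]
    omega

theorem rank_inner (w : Fin n → Bool) (i : Fin n) :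
    rank w (some (i, 1)) = 1 + 4 * i + if w i then 1 else 2 := by
  cases h : w i <;> simp [rank, h]

theorem rank_inner_eq_left (w : Fin n → Bool) (i : Fin n) :
    rank w (some (i, 1)) = rank w (some (i, 0)) + 1 := by
  cases h : w i <;> simp [rank, h]

theorem rank_right_eq (w : Fin n → Bool) (i : Fin n) :
    rank w (some (i, 2)) = rank w (some (i, 1)) + 1 := by
  cases h : w i <;> simp [rank, h]

theorem card_pt : Fintype.card (Pt n) = 4 * n + 1 := by
  simp [Fintype.card_option, mul_comm]

/-- `rank w` as a bijection. -/
noncomputable def rankEquiv (w : Fin n → Bool) : Pt n ≃ Fin (4 * n + 1) :=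
  Equiv.ofBijective (fun y => ⟨rank w y, rank_lt w y⟩)
    ((Fintype.bijective_iff_injective_and_card _).2
      ⟨fun _ _ h => rank_injective w (congrArg Fin.val h), by rw [card_pt, Fintype.card_fin]⟩)

theorem rankEquiv_val (w : Fin n → Bool) (y : Pt n) : (rankEquiv w y : ℕ) = rank w y := rfl

/-- The height of a point above the parabola. -/
noncomputable def height : Pt n → ℝ
  | none => 0
  | some (_, c) => if c = 1 then 3 / 2 else 0

theorem height_inner (i : Fin n) : height (some (i, 1)) = 3 / 2 := by simp [height]

theorem height_of_ne {y : Pt n} (hy : ∀ i, y ≠ some (i, 1)) : height y = 0 := by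
  rcases y with _ | ⟨i, c⟩
  · rfl
  · have hc : c ≠ 1 := fun h => hy i (by rw [h])
    simp [height, hc]

theorem height_nonneg (y : Pt n) : 0 ≤ height y := by
  by_cases hy : ∃ i, y = some (i, 1)
  · obtain ⟨i, rfl⟩ := hy
    norm_num [height_inner]
  · exact (height_of_ne (not_exists.1 hy)).ge

/-- The point configuration given by `w`. -/
noncomputable def place (w : Fin n → Bool) (y : Pt n) : ℝ × ℝ :=
  (rank w y, (rank w y : ℝ) ^ 2 + height y)

theorem place_injective (w : Fin n → Bool) : Function.Injective (place w) := fun _ _ h =>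
  rank_injective w (Nat.cast_injective (R := ℝ) (congrArg Prod.fst h))

/-- The determinant whose sign is the orientation. -/
def area (x y z : ℝ × ℝ) : ℝ := (y.1 - x.1) * (z.2 - x.2) - (y.2 - x.2) * (z.1 - x.1)

/-! ### Orientations of the placed points. -/

theorem area_eq_zero_of_collinear {x y z : ℝ × ℝ} (h : Collinear ℝ {x, y, z}) :
    area x y z = 0 := by
  obtain ⟨v, hv⟩ := (collinear_iff_of_mem (p₀ := x) (by simp)).1 h
  obtain ⟨s, rfl⟩ := hv y (by simp)
  obtain ⟨t, rfl⟩ := hv z (by simp)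
  simp [area]
  ring

theorem area_place_neg (w : Fin n → Bool) (i : Fin n) :
    area (place w (some (i, 0))) (place w (some (i, 1))) (place w (some (i, 2))) < 0 := by
  have h0 : height (some (i, 0)) = 0 := by simp [height]
  have h2 : height (some (i, 2)) = 0 := by simp [height]
  simp only [area, place, rank_right_eq, rank_inner_eq_left, height_inner, h0, h2]
  push_cast
  ring_nf
  norm_num

/-- Up to the nonnegative terms from `height a` and `height c`, the sign is that of the product of
the two rank gaps minus `height b`. This product is at least `2 > 3 / 2` unless both gaps are `1`,
which for an inner point `b` is the excluded triple. -/
theorem area_place_pos (w : Fin n → Bool) {a b c : Pt n} (hab : rank w a < rank w b)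
    (hbc : rank w b < rank w c)
    (h : ¬ ∃ i, a = some (i, 0) ∧ b = some (i, 1) ∧ c = some (i, 2)) :
    0 < area (place w a) (place w b) (place w c) := by
  obtain ⟨u, hu⟩ := Nat.exists_eq_add_of_lt hab
  obtain ⟨v, hv⟩ := Nat.exists_eq_add_of_lt hbc
  have key : height b < ((u : ℝ) + 1) * ((v : ℝ) + 1) := by
    by_cases hb : ∃ i, b = some (i, 1)
    · obtain ⟨i, rfl⟩ := hb
      have huv : 1 ≤ u + v := by
        by_contra huv
        refine h ⟨i, rank_injective w ?_, rfl, rank_injective w ?_⟩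
        · have := rank_inner_eq_left w i
          omega
        · have := rank_right_eq w i
          omega
      have huv' : (1 : ℝ) ≤ u + v := by exact_mod_cast huv
      have : (0 : ℝ) ≤ (u : ℝ) * v := by positivity
      rw [height_inner]
      nlinarith
    · rw [height_of_ne (not_exists.1 hb)]
      positivity
  have ha := height_nonneg a
  have hc := height_nonneg c
  have e : area (place w a) (place w b) (place w c) =
      (((u : ℝ) + 1) * ((v : ℝ) + 1) - height b) * ((u : ℝ) + v + 2)
        + height a * ((v : ℝ) + 1) + height c * ((u : ℝ) + 1) := by
    simp only [area, place, hv, hu]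
    push_cast
    ring
  rw [e]
  have := mul_pos (sub_pos.2 key) (by positivity : (0 : ℝ) < (u : ℝ) + v + 2)
  positivity

theorem area_place_ne_zero_of_lt (w : Fin n → Bool) {a b c : Pt n} (hab : rank w a < rank w b)
    (hbc : rank w b < rank w c) : area (place w a) (place w b) (place w c) ≠ 0 := by
  by_cases h : ∃ i, a = some (i, 0) ∧ b = some (i, 1) ∧ c = some (i, 2)
  · obtain ⟨i, rfl, rfl, rfl⟩ := h
    exact (area_place_neg w i).ne
  · exact (area_place_pos w hab hbc h).ne'

theorem area_swap_left (x y z : ℝ × ℝ) : area x y z = -area y x z := by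
  simp only [area]
  ring

theorem area_swap_right (x y z : ℝ × ℝ) : area x y z = -area x z y := by
  simp only [area]
  ring

theorem area_place_ne_zero (w : Fin n → Bool) {a b c : Pt n} (hab : a ≠ b) (hac : a ≠ c)
    (hbc : b ≠ c) : area (place w a) (place w b) (place w c) ≠ 0 := by
  have hab' := (rank_injective w).ne hab
  have hac' := (rank_injective w).ne hac
  have hbc' := (rank_injective w).ne hbc
  rcases lt_or_gt_of_ne hab' with h1 | h1 <;> rcases lt_or_gt_of_ne hbc' with h2 | h2 <;>
    rcases lt_or_gt_of_ne hac' with h3 | h3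
  · exact area_place_ne_zero_of_lt w h1 h2
  · omega
  · rw [area_swap_right, neg_ne_zero]
    exact area_place_ne_zero_of_lt w h3 h2
  · rw [area_swap_right, area_swap_left, neg_neg]
    exact area_place_ne_zero_of_lt w h3 h1
  · rw [area_swap_left, neg_ne_zero]
    exact area_place_ne_zero_of_lt w h1 h3
  · rw [area_swap_left, area_swap_right, neg_neg]
    exact area_place_ne_zero_of_lt w h2 h3
  · omega
  · rw [area_swap_left, area_swap_right, area_swap_left, neg_neg, neg_ne_zero]
    exact area_place_ne_zero_of_lt w h2 h1

theorem inGeneralPosition_place (w : Fin n → Bool) : InGeneralPosition (place w) :=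
  ⟨place_injective w, fun _ _ _ hab hac hbc h =>
    area_place_ne_zero w hab hac hbc (area_eq_zero_of_collinear h)⟩

/-! ### Convex hulls of the placed points. -/

theorem lt_of_mem_convexHull {S : Set (ℝ × ℝ)} {α β d : ℝ}
    (hS : ∀ q ∈ S, d < α * q.1 + β * q.2) {q : ℝ × ℝ} (hq : q ∈ convexHull ℝ S) :
    d < α * q.1 + β * q.2 := by
  have hlin : IsLinearMap ℝ fun q : ℝ × ℝ => α * q.1 + β * q.2 :=
    ⟨fun x y => by simp; ring, fun c x => by simp; ring⟩
  exact convexHull_min hS (convex_halfSpace_gt hlin d) hq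

/-- A shear and a translation preserve the parabola and move its point of abscissa `rank w x` to the
origin, so separating lines can be given in local coordinates. -/
theorem place_notMem_convexHull_of_forall_lt (w : Fin n → Bool) {Y : Set (Pt n)} {x : Pt n}
    (α β : ℝ)
    (h : ∀ y ∈ Y, 0 < α * ((rank w y : ℝ) - rank w x) +
      β * (((rank w y : ℝ) - rank w x) ^ 2 + height y - height x)) :
    place w x ∉ convexHull ℝ (place w '' Y) := by
  intro hx
  refine lt_irrefl _ (lt_of_mem_convexHull (α := α - 2 * β * rank w x) (β := β)
    (d := (α - 2 * β * rank w x) * (place w x).1 + β * (place w x).2) ?_ hx)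
  rintro _ ⟨y, hy, rfl⟩
  have := h y hy
  simp only [place]
  linarith

theorem mem_of_place_mem_convexHull (w : Fin n → Bool) {Y : Set (Pt n)} {x : Pt n}
    (hx : ∀ i, x ≠ some (i, 1)) (h : place w x ∈ convexHull ℝ (place w '' Y)) : x ∈ Y := by
  by_contra hxY
  refine place_notMem_convexHull_of_forall_lt w (x := x) 0 1 (fun y hy => ?_) h
  have hne : (rank w y : ℝ) - rank w x ≠ 0 :=
    sub_ne_zero.2 (Nat.cast_injective.ne ((rank_injective w).ne fun e => hxY (e ▸ hy)))
  have := pow_pos (abs_pos.2 hne) 2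
  rw [sq_abs] at this
  rw [height_of_ne hx]
  linarith [height_nonneg y]

theorem inner_mem_of_place_mem_convexHull (w : Fin n → Bool) {Y : Set (Pt n)} {i : Fin n}
    (h : place w (some (i, 1)) ∈ convexHull ℝ (place w '' Y)) : some (i, 1) ∈ addInner Y := by
  by_contra hxY
  have hx : some (i, 1) ∉ Y := fun h => hxY (Or.inl h)
  have hl := rank_inner_eq_left w i
  have hr := rank_right_eq w i
  by_cases h0 : some (i, 0) ∈ Y
  · by_cases h2 : some (i, 2) ∈ Y
    -- Here `Y` is just the edge, which lies below the inner point.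
    · refine place_notMem_convexHull_of_forall_lt w (x := some (i, 1)) 0 (-1) (fun y hy => ?_) h
      have hy' : y = some (i, 0) ∨ y = some (i, 2) := by
        by_contra! hne
        exact hxY (Or.inr ⟨i, rfl, h0, h2, y, hy, hne⟩)
      rcases hy' with rfl | rfl
      · rw [hl, height_inner, height_of_ne (by simp)]
        push_cast
        ring_nf
        norm_num
      · rw [hr, height_inner, height_of_ne (by simp)]
        push_cast
        ring_nf
        norm_num
    -- Without the right end, the rank offsets in `Y` are at most `-1` or at least `2`. A slope of
    -- absolute value strictly between `1 / 2` and `5 / 4` clears both ranges; the other case is its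
    -- mirror image.
    · refine place_notMem_convexHull_of_forall_lt w (x := some (i, 1)) (-3 / 4) 1
        (fun y hy => ?_) h
      have n1 := (rank_injective w).ne (show y ≠ some (i, 1) from fun e => hx (e ▸ hy))
      have n2 := (rank_injective w).ne (show y ≠ some (i, 2) from fun e => h2 (e ▸ hy))
      have hy0 := height_nonneg y
      rw [height_inner]
      rcases lt_or_gt_of_ne n1 with hlt | hgt
      · have : (rank w y : ℝ) + 1 ≤ rank w (some (i, 1)) := by exact_mod_cast hlt
        nlinarith
      · have : (rank w (some (i, 1)) : ℝ) + 2 ≤ rank w y := by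
          exact_mod_cast (by omega : rank w (some (i, 1)) + 2 ≤ rank w y)
        nlinarith
  · refine place_notMem_convexHull_of_forall_lt w (x := some (i, 1)) (3 / 4) 1
      (fun y hy => ?_) h
    have n1 := (rank_injective w).ne (show y ≠ some (i, 1) from fun e => hx (e ▸ hy))
    have n2 := (rank_injective w).ne (show y ≠ some (i, 0) from fun e => h0 (e ▸ hy))
    have hy0 := height_nonneg y
    rw [height_inner]
    rcases lt_or_gt_of_ne n1 with hlt | hgt
    · have : (rank w y : ℝ) + 2 ≤ rank w (some (i, 1)) := by
        exact_mod_cast (by omega : rank w y + 2 ≤ rank w (some (i, 1)))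
      nlinarith
    · have : (rank w (some (i, 1)) : ℝ) + 1 ≤ rank w y := by exact_mod_cast hgt
      nlinarith

theorem mem_convexHull_of_three {S : Set (ℝ × ℝ)} {α β γ : ℝ} (hα : 0 ≤ α) (hβ : 0 ≤ β)
    (hγ : 0 ≤ γ) (h : α + β + γ = 1) {x y z : ℝ × ℝ} (hx : x ∈ S) (hy : y ∈ S) (hz : z ∈ S) :
    α • x + β • y + γ • z ∈ convexHull ℝ S := by
  have hS := subset_convexHull ℝ S
  have := (convex_convexHull ℝ S).sum_mem (t := Finset.univ) (w := ![α, β, γ]) (z := ![x, y, z])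
    (by simp [Fin.forall_fin_succ, hα, hβ, hγ]) (by simpa [Fin.sum_univ_three] using h)
    (by simp [Fin.forall_fin_succ, hS hx, hS hy, hS hz])
  simpa [Fin.sum_univ_three] using this

theorem place_inner_mem_convexHull (w : Fin n → Bool) {Y : Set (Pt n)} {i : Fin n} {z : Pt n}
    (h0 : some (i, 0) ∈ Y) (h2 : some (i, 2) ∈ Y) (hz : z ∈ Y) (hz0 : z ≠ some (i, 0))
    (hz1 : z ≠ some (i, 1)) (hz2 : z ≠ some (i, 2)) :
    place w (some (i, 1)) ∈ convexHull ℝ (place w '' Y) := by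
  have hl := rank_inner_eq_left w i
  have hr := rank_right_eq w i
  have n0 := (rank_injective w).ne hz0
  have n1 := (rank_injective w).ne hz1
  have n2 := (rank_injective w).ne hz2
  obtain ⟨u, hu⟩ : ∃ u : ℝ, u = (rank w z : ℝ) - rank w (some (i, 1)) := ⟨_, rfl⟩
  have hu2 : 2 ≤ u ∨ u ≤ -2 := by
    rcases lt_or_gt_of_ne n1 with hlt | hgt
    · right
      have : (rank w z : ℝ) + 2 ≤ rank w (some (i, 1)) := by
        exact_mod_cast (by omega : rank w z + 2 ≤ rank w (some (i, 1)))
      linarith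
    · left
      have : (rank w (some (i, 1)) : ℝ) + 2 ≤ rank w z := by
        exact_mod_cast (by omega : rank w (some (i, 1)) + 2 ≤ rank w z)
      linarith
  have hh := height_nonneg z
  have hd : 0 < 2 * (u ^ 2 + height z - 1) := by rcases hu2 with h | h <;> nlinarith
  -- In local coordinates the ends are `(-1, 1)` and `(1, 1)`, the third point is `(u, u ^ 2 +
  -- height z)` and the target is `(0, 3 / 2)`. The second coordinate forces this weight `γ` of `z`,
  -- and the first then fixes the weights of the ends.
  obtain ⟨γ, hγ⟩ : ∃ γ : ℝ, γ = 1 / (2 * (u ^ 2 + height z - 1)) := ⟨_, rfl⟩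
  have hγ0 : 0 < γ := hγ ▸ one_div_pos.2 hd
  have hγ1 : γ * (2 * (u ^ 2 + height z - 1)) = 1 := by
    rw [hγ]
    exact one_div_mul_cancel hd.ne'
  have hα : 0 ≤ (1 - γ + γ * u) / 2 := by
    have : γ * (1 - u) ≤ 1 := by
      rw [← hγ1]
      exact mul_le_mul_of_nonneg_left (by rcases hu2 with h | h <;> nlinarith) hγ0.le
    linarith
  have hβ : 0 ≤ (1 - γ - γ * u) / 2 := by
    have : γ * (1 + u) ≤ 1 := by
      rw [← hγ1]
      exact mul_le_mul_of_nonneg_left (by rcases hu2 with h | h <;> nlinarith) hγ0.le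
    linarith
  have hrl : (rank w (some (i, 1)) : ℝ) = rank w (some (i, 0)) + 1 := by exact_mod_cast hl
  have hrr : (rank w (some (i, 2)) : ℝ) = rank w (some (i, 0)) + 2 := by
    exact_mod_cast (by omega : rank w (some (i, 2)) = rank w (some (i, 0)) + 2)
  have hrz : (rank w z : ℝ) = rank w (some (i, 0)) + 1 + u := by linarith
  have e : place w (some (i, 1)) = ((1 - γ + γ * u) / 2) • place w (some (i, 0)) +
      ((1 - γ - γ * u) / 2) • place w (some (i, 2)) + γ • place w z := by
    have h0' : height (some (i, 0)) = 0 := by simp [height]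
    have h2' : height (some (i, 2)) = 0 := by simp [height]
    ext
    · simp only [place, Prod.fst_add, Prod.smul_fst, smul_eq_mul, hrl, hrr, hrz]
      ring
    · simp only [place, Prod.snd_add, Prod.smul_snd, smul_eq_mul, hrl, hrr, hrz, h0', h2',
        height_inner]
      linear_combination -hγ1 / 2
  rw [e]
  exact mem_convexHull_of_three hα hβ hγ0.le (by ring) ⟨_, h0, rfl⟩ ⟨_, h2, rfl⟩ ⟨_, hz, rfl⟩

theorem isRealization_place (w : Fin n → Bool) : IsRealization (edgeClosure n) (place w) := by
  refine ⟨inGeneralPosition_place w, fun Y => Set.Subset.antisymm ?_ ?_⟩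
  · rintro _ ⟨y, hy, rfl⟩
    refine ⟨?_, y, rfl⟩
    rcases hy with hy | ⟨i, rfl, h0, h2, z, hz, hz0, hz2⟩
    · exact subset_convexHull ℝ _ ⟨y, hy, rfl⟩
    · by_cases hz1 : z = some (i, 1)
      · exact subset_convexHull ℝ _ ⟨z, hz, by rw [hz1]⟩
      · exact place_inner_mem_convexHull w h0 h2 hz hz0 hz1 hz2
  · rintro _ ⟨hy, y, rfl⟩
    refine ⟨y, ?_, rfl⟩
    by_cases hy1 : ∃ i, y = some (i, 1)
    · obtain ⟨i, rfl⟩ := hy1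
      exact inner_mem_of_place_mem_convexHull w hy
    · exact Or.inl (mem_of_place_mem_convexHull w (not_exists.1 hy1) hy)

/-! ### Counting order types -/

theorem rank_none (w : Fin n → Bool) : rank w none = 0 := rfl

theorem rank_pos (w : Fin n → Bool) {y : Pt n} (hy : y ≠ none) : 0 < rank w y :=
  Nat.pos_of_ne_zero fun h => hy (rank_injective w h)

/-- The base point is leftmost, so the order type sees the others in rank order around it. -/
theorem orientation_place_none (w : Fin n → Bool) {y z : Pt n} (hy : y ≠ none) (hz : z ≠ none)
    (hyz : y ≠ z) :
    orientation (place w none) (place w y) (place w z) = 1 ↔ rank w y < rank w z := by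
  have key : ∀ {y z : Pt n}, y ≠ none → rank w y < rank w z →
      0 < area (place w none) (place w y) (place w z) := fun hy h =>
    area_place_pos w (rank_pos w hy) h (by simp)
  refine sign_eq_one_iff.trans ⟨fun h => ?_, key hy⟩
  by_contra hle
  have hlt : rank w z < rank w y := lt_of_le_of_ne (not_lt.1 hle) ((rank_injective w).ne hyz.symm)
  have := key hz hlt
  rw [area_swap_right] at this
  exact lt_asymm h (neg_pos.1 this)

theorem eq_of_orderTypeOf_eq_comp {w w' : Fin n → Bool} {δ : Equiv.Perm (Pt n)}
    (hδ : δ none = none)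
    (h : orderTypeOf (place w') = orderTypeOf (place w) ∘ OrderedTriple.map δ) : w' = w := by
  have hne : ∀ {y}, y ≠ none → δ y ≠ none := fun hy e => hy (δ.injective (e.trans hδ.symm))
  have hlt : ∀ {y z}, rank w' y < rank w' z ↔ rank w (δ y) < rank w (δ z) := by
    intro y z
    by_cases hy : y = none
    · subst hy
      by_cases hz : z = none
      · subst hz
        simp
      · rw [hδ]
        exact iff_of_true (rank_pos w' hz) (rank_pos w (hne hz))
    by_cases hz : z = none
    · subst hz
      simp [hδ, rank_none]
    by_cases hyz : y = z
    · subst hyz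
      simp
    rw [← orientation_place_none w' hy hz hyz,
      ← orientation_place_none w (hne hy) (hne hz) (δ.injective.ne hyz)]
    have := congrFun h ⟨none, y, z, Ne.symm hy, Ne.symm hz, hyz⟩
    simp only [orderTypeOf, OrderedTriple.map, Function.comp, hδ] at this
    rw [this]
  have hrank : ∀ y, rank w (δ y) = rank w' y := by
    -- In terms of ranks, `δ` is an order automorphism of a finite chain, hence the identity.
    let e : Fin (4 * n + 1) ≃o Fin (4 * n + 1) := StrictMono.orderIsoOfSurjective
      (fun k => rankEquiv w (δ ((rankEquiv w').symm k)))
      (fun a b hab => by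
        rw [Fin.lt_def, rankEquiv_val, rankEquiv_val, ← hlt, ← rankEquiv_val, ← rankEquiv_val]
        simpa using hab)
      (((rankEquiv w').symm.trans δ).trans (rankEquiv w)).surjective
    intro y
    have he : e (rankEquiv w' y) = rankEquiv w' y := by
      rw [Subsingleton.elim e (OrderIso.refl _)]
      rfl
    have he' : e (rankEquiv w' y) = rankEquiv w (δ y) :=
      congrArg (fun z => rankEquiv w (δ z)) ((rankEquiv w').symm_apply_apply y)
    rw [← rankEquiv_val, ← he', he, rankEquiv_val]
  funext i
  have hl := rank_inner_eq_left w' i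
  have hr := rank_right_eq w' i
  -- Any other image triple, being increasing in rank, would be anticlockwise.
  obtain ⟨j, -, hj, -⟩ : ∃ j, δ (some (i, 0)) = some (j, 0) ∧ δ (some (i, 1)) = some (j, 1) ∧
      δ (some (i, 2)) = some (j, 2) := by
    by_contra hcon
    have hpos := area_place_pos w (hlt.1 (by omega)) (hlt.1 (by omega)) hcon
    have hneg := area_place_neg w' i
    have := congrFun h ⟨some (i, 0), some (i, 1), some (i, 2), by simp, by simp, by simp⟩
    have h1 : SignType.sign (area (place w' (some (i, 0))) (place w' (some (i, 1)))
        (place w' (some (i, 2)))) = SignType.sign (area (place w (δ (some (i, 0))))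
          (place w (δ (some (i, 1)))) (place w (δ (some (i, 2))))) := this
    rw [sign_neg hneg, sign_pos hpos] at h1
    exact absurd h1 (by decide)
  have hi := hrank (some (i, 1))
  rw [hj, rank_inner, rank_inner] at hi
  have hij : j = i := by
    apply Fin.ext
    split_ifs at hi <;> omega
  subst hij
  cases h1 : w j <;> cases h2 : w' j <;> simp [h1, h2] at hi ⊢

instance finite_orderedTriple {J : Type*} [Finite J] : Finite (OrderedTriple J) :=
  Finite.of_injective (fun s => (s.fst, s.snd, s.thd)) fun s t h => by
    simp only [Prod.mk.injEq] at h
    exact OrderedTriple.ext h.1 h.2.1 h.2.2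

theorem two_pow_le_numOrderTypes_mul (n : ℕ) :
    2 ^ n ≤ numOrderTypes (edgeClosure n) * (4 * n + 1) := by
  let Q := Quotient (orderTypesSetoid (edgeClosure n))
  let T (w : Fin n → Bool) : OrderTypes (edgeClosure n) :=
    ⟨orderTypeOf (place w), place w, isRealization_place w, rfl⟩
  let cls (w : Fin n → Bool) : Q := Quotient.mk _ (T w)
  have hrep : ∀ w, ∃ δ : Equiv.Perm (Pt n),
      (cls w).out.1 = orderTypeOf (place w) ∘ OrderedTriple.map δ := fun w =>
    Quotient.exact (s := orderTypesSetoid (edgeClosure n)) (Quotient.out_eq (cls w)).symm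
  choose δ hδ using hrep
  -- A word is recovered from its class and the point that the chosen relabelling sends to `none`:
  -- if both agree, the composite relabelling fixes `none`.
  have hinj : Function.Injective fun w => (cls w, (δ w).symm none) := by
    intro w' w h
    obtain ⟨hc, hn⟩ := Prod.mk.inj h
    refine eq_of_orderTypeOf_eq_comp (δ := (δ w').symm.trans (δ w)) ?_ ?_
    · simp [hn]
    · have h' := hδ w'
      rw [hc, hδ w] at h'
      funext s
      have := congrFun h' (OrderedTriple.map (δ w').symm s)
      simpa [OrderedTriple.map] using this.symm
  have : Finite Q := Quotient.finite _
  have := Nat.card_le_card_of_injective _ hinj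
  rw [Nat.card_prod] at this
  change _ ≤ Nat.card Q * _
  simpa [Nat.card_eq_fintype_card, mul_comm 4 n] using this

/-! ### Asymptotics. -/

theorem tendsto_eval_div_two_pow (P : Polynomial ℝ) :
    Tendsto (fun p : ℕ => P.eval (p : ℝ) / 2 ^ p) atTop (𝓝 0) := by
  induction P using Polynomial.induction_on' with
  | add P Q hP hQ => simpa [add_div] using hP.add hQ
  | monomial k c =>
    simpa [mul_div_assoc] using
      (tendsto_pow_const_div_const_pow_of_one_lt k (one_lt_two (α := ℝ))).const_mul c

theorem eventually_eval_lt_numOrderTypes (P : Polynomial ℝ) :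
    ∀ᶠ p : ℕ in atTop, P.eval (p : ℝ) < (numOrderTypes (edgeClosure (p + 1)) : ℝ) := by
  -- The factor `4 * X + 5` is the number of points `4 * (p + 1) + 1`; the shift to `p + 1` blocks
  -- keeps the inner layer nonempty at `p = 0`.
  have h := (tendsto_eval_div_two_pow (P * (4 * Polynomial.X + 5))).eventually_lt_const
    (zero_lt_one (α := ℝ))
  filter_upwards [h] with p hp
  rw [div_lt_one (by positivity)] at hp
  have hle : (2 : ℝ) ^ (p + 1) ≤
      (numOrderTypes (edgeClosure (p + 1)) : ℝ) * (4 * ((p : ℝ) + 1) + 1) := by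
    exact_mod_cast two_pow_le_numOrderTypes_mul (p + 1)
  have hp' : P.eval (p : ℝ) * (4 * (p : ℝ) + 5) < 2 ^ p := by simpa using hp
  have h2 : (2 : ℝ) ^ p ≤ 2 ^ (p + 1) := pow_le_pow_right₀ one_le_two p.le_succ
  refine lt_of_mul_lt_mul_right (a := 4 * (p : ℝ) + 5) ?_ (by positivity)
  linarith

theorem tendsto_card_div :
    Tendsto (fun p : ℕ => (Nat.card (Pt (p + 1)) : ℝ) / (p : ℝ)) atTop (𝓝 4) := by
  have h : Tendsto (fun p : ℕ => 4 + 5 / (p : ℝ)) atTop (𝓝 (4 + 0)) :=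
    (tendsto_const_div_atTop_nhds_zero_nat (5 : ℝ)).const_add 4
  rw [add_zero] at h
  refine h.congr' ?_
  filter_upwards [eventually_gt_atTop 0] with p hp
  have : (p : ℝ) ≠ 0 := by exact_mod_cast hp.ne'
  rw [Nat.card_eq_fintype_card, card_pt]
  push_cast
  field_simp
  ring

end EdgeWords

theorem mainTheorem5 :
    ∃ (J : ℕ → Type) (cl : ∀ p : ℕ, ClosureOperator (Set (J p))),
      (∀ p : ℕ, ConvexGeom.IsConvexFourGeometry (cl p) ∧
        ConvexGeom.HasExactlyLayers (cl p) 2 ∧ ConvexGeom.IsRealizable (cl p)) ∧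
      (∃ c : ℝ, 0 < c ∧ Tendsto (fun p : ℕ => (Nat.card (J p) : ℝ) / (p : ℝ)) atTop (𝓝 c)) ∧
      ∀ P : Polynomial ℝ, ∀ᶠ p : ℕ in atTop,
        P.eval (p : ℝ) < (ConvexGeom.numOrderTypes (cl p) : ℝ) :=
  ⟨fun p => EdgeWords.Pt (p + 1), fun p => EdgeWords.edgeClosure (p + 1),
    fun _ => ⟨EdgeWords.isConvexFourGeometry_edgeClosure, EdgeWords.hasExactlyLayers_edgeClosure,
      _, EdgeWords.isRealization_place fun _ => true⟩,
    ⟨4, by norm_num, EdgeWords.tendsto_card_div⟩, EdgeWords.eventually_eval_lt_numOrderTypes⟩
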